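/- Let $K$ be an algebraically closed field of characteristic $3$. A projective variety over $K$ is understood to be reduced and irreducible. For a very ample line bundle $A$ on a projective variety $X$, let $I(X,A)$ denote the homogeneous ideal of $X$ in the embedding $X\subset\mathbb P(H^0(X,A))$ given by the complete linear series $|A|$. Say that $(X,A)$ satisfies property $\mathsf{QR}(k)$ if $I(X,A)$ is generated by quadratic forms of rank at most $k$; if $I(X,A)$ is generated by quadratic forms, let $\operatorname{rank-index}(X,A)$ be the least integer $k$ for which $(X,A)$ satisfies $\mathsf{QR}(k)$. (An equality $\operatorname{rank-index}(X,A)=3$ includes the assertion that $I(X,A)$ is generated by quadratic forms.) (1) $\operatorname{rank-index}(\mathbb P^n,\mathcal O_{\mathbb P^n}(d))=3$ for all $n\ge 2$ and $d\ge 3$. (2) Let $X$ be a projective variety over $K$ of positive dimension and let $L$ be a very ample line bundle on $X$, defining the linearly normal embedding $X\subset\mathbb P^r$, $r=h^0(X,L)-1$. Let $m\ge 3$ be an integer such that $X\subset\mathbb P^r$ is $j$-normal for all $j\ge m$ (that is, the restriction map $H^0(\mathbb P^r,\mathcal O_{\mathbb P^r}(j))\to H^0(X,L^{j})$ is surjective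 for all $j\ge m$) and $I(X,L)$ is generated by forms of degree at most $m$. Then $$\operatorname{rank-index}(X,L^d)=3\quad\text{for all } d\ge m .$$ -/

import Mathlib

open scoped LinearAlgebra.Projectivization

/-- The points of projective `r`-space over `K`. -/
abbrev PSpace (K : Type*) [Field K] (r : ℕ) : Type _ := ℙ K (Fin (r + 1) → K)

section Varieties

variable {K : Type*} [Field K] {r : ℕ}

/-- The punctured affine cone over a set of points of projective space: all coordinate vectors
of all points of `X`. -/
def affineCone (X : Set (PSpace K r)) : Set (Fin (r + 1) → K) :=
  {v | ∃ h : v ≠ 0, Projectivization.mk K v h ∈ X}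

/-- Zariski closed subsets of projective space: the common zero loci of sets of forms. -/
def IsZariskiClosed (X : Set (PSpace K r)) : Prop :=
  ∃ S : Set (MvPolynomial (Fin (r + 1)) K),
    (∀ F ∈ S, ∃ e : ℕ, F.IsHomogeneous e) ∧
      X = {p | ∀ F ∈ S, ∀ v ∈ affineCone {p}, MvPolynomial.eval v F = 0}

/-- A projective variety over an algebraically closed field, as an embedded object: a nonempty
irreducible Zariski closed subset of projective space (with its reduced structure). -/
structure IsProjectiveVariety (X : Set (PSpace K r)) : Prop where
  closed : IsZariskiClosed X
  nonempty : X.Nonempty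
  irreducible : ∀ Y Z : Set (PSpace K r), IsZariskiClosed Y → IsZariskiClosed Z →
    X ⊆ Y ∪ Z → X ⊆ Y ∨ X ⊆ Z

/-- The homogeneous ideal of a set of points of projective space: the polynomials that vanish at
all coordinate vectors of all its points. (Over an infinite field this ideal is homogeneous.) -/
def homogeneousIdeal (X : Set (PSpace K r)) : Ideal (MvPolynomial (Fin (r + 1)) K) where
  carrier := {F | ∀ v ∈ affineCone X, MvPolynomial.eval v F = 0}
  add_mem' := by
    intro F G hF hG v hv
    rw [map_add, hF v hv, hG v hv, add_zero]
  zero_mem' := by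
    intro v _
    exact map_zero _
  smul_mem' := by
    intro c F hF v hv
    rw [smul_eq_mul, map_mul, hF v hv, mul_zero]

/-- The space `H⁰(X, O_X(j))` of global sections of the `j`-th power of the hyperplane bundle of
`X ⊂ ℙ^r`: the functions on the punctured affine cone of `X` which, near every point, are a
quotient `F / G` of two forms with `deg F = deg G + j` and `G` nowhere zero. -/
def sections (X : Set (PSpace K r)) (j : ℕ) : Submodule K (affineCone X → K) where
  carrier := {s | ∀ v : affineCone X, ∃ (e : ℕ) (F G : MvPolynomial (Fin (r + 1)) K),
    F.IsHomogeneous (e + j) ∧ G.IsHomogeneous e ∧ MvPolynomial.eval v.1 G ≠ 0 ∧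
      ∀ w : affineCone X, MvPolynomial.eval w.1 G ≠ 0 →
        s w = MvPolynomial.eval w.1 F / MvPolynomial.eval w.1 G}
  add_mem' := by
    intro s t hs ht v
    obtain ⟨e, F, G, hF, hG, hv, h⟩ := hs v
    obtain ⟨e', F', G', hF', hG', hv', h'⟩ := ht v
    refine ⟨e + e', F * G' + G * F', G * G', ?_, hG.mul hG', ?_, ?_⟩
    · refine MvPolynomial.IsHomogeneous.add ?_ ?_
      · convert hF.mul hG' using 1
        omega
      · convert hG.mul hF' using 1
        omega
    · rw [map_mul]
      exact mul_ne_zero hv hv'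
    · intro w hw
      rw [map_mul] at hw
      have h1 := left_ne_zero_of_mul hw
      have h2 := right_ne_zero_of_mul hw
      rw [Pi.add_apply, h w h1, h' w h2, div_add_div _ _ h1 h2]
      simp only [map_add, map_mul]
  zero_mem' := by
    intro v
    refine ⟨0, 0, 1, MvPolynomial.isHomogeneous_zero _ _ _, MvPolynomial.isHomogeneous_one _ _,
      ?_, ?_⟩
    · simp
    · intro w _
      simp
  smul_mem' := by
    intro c s hs v
    obtain ⟨e, F, G, hF, hG, hv, h⟩ := hs v
    refine ⟨e, MvPolynomial.C c * F, G, hF.C_mul c, hG, hv, ?_⟩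
    intro w hw
    rw [Pi.smul_apply, h w hw, smul_eq_mul, map_mul, MvPolynomial.eval_C, mul_div_assoc]

/-- The restriction map `H⁰(ℙ^r, O(j)) → H⁰(X, O_X(j))` on forms of degree `j`. -/
noncomputable def restrictForms (X : Set (PSpace K r)) (j : ℕ) :
    MvPolynomial.homogeneousSubmodule (Fin (r + 1)) K j →ₗ[K] sections X j where
  toFun F := ⟨fun v => MvPolynomial.eval v.1 F.1, fun v =>
    ⟨0, F.1, 1, by
      rw [zero_add]
      exact F.2, MvPolynomial.isHomogeneous_one _ _, by simp, fun w _ => by simp⟩⟩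
  map_add' := by
    intro F G
    ext v
    simp
  map_smul' := by
    intro c F
    ext v
    simp [MvPolynomial.smul_eval]

/-- `X ⊂ ℙ^r` is `j`-normal: forms of degree `j` cut out a complete linear series on `X`. -/
def IsNormalInDegree (X : Set (PSpace K r)) (j : ℕ) : Prop :=
  Function.Surjective (restrictForms X j)

/-- `X ⊂ ℙ^r` is embedded by the complete linear series of its hyperplane bundle `L = O_X(1)`:
the restriction `H⁰(ℙ^r, O(1)) → H⁰(X, L)` is an isomorphism. -/
def IsLinearlyNormallyEmbedded (X : Set (PSpace K r)) : Prop :=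
  Function.Bijective (restrictForms X 1)

/-- `I(X)` is generated by forms of degree at most `m`. -/
def IdealGeneratedInDegreeLE (X : Set (PSpace K r)) (m : ℕ) : Prop :=
  homogeneousIdeal X =
    Ideal.span {F | F ∈ homogeneousIdeal X ∧ ∃ e ≤ m, F.IsHomogeneous e}

/-- The polynomial `q` is the quadratic form of a symmetric matrix of rank `ρ`.
(The matrix is unique when `2` is invertible in `K`.) -/
def IsQuadricOfRank (q : MvPolynomial (Fin (r + 1)) K) (ρ : ℕ) : Prop :=
  ∃ A : Matrix (Fin (r + 1)) (Fin (r + 1)) K, A.IsSymm ∧ A.rank = ρ ∧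
    q = ∑ i, ∑ j, MvPolynomial.C (A i j) * (MvPolynomial.X i * MvPolynomial.X j)

/-- Property `QR(k)` of a subset of projective space: its homogeneous ideal is generated by
quadrics of rank at most `k`. -/
def PropertyQR (Y : Set (PSpace K r)) (k : ℕ) : Prop :=
  homogeneousIdeal Y =
    Ideal.span {q | q ∈ homogeneousIdeal Y ∧ ∃ ρ ≤ k, IsQuadricOfRank q ρ}

/-- The image of `X` under the map `X → ℙ^N`, `p ↦ [s₀(p) : ⋯ : s_N(p)]`, given by sections
`s₀, …, s_N` of `O_X(d)`. -/
def imageBySections (X : Set (PSpace K r)) {d N : ℕ} (s : Fin (N + 1) → sections X d) :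
    Set (PSpace K N) :=
  {q | ∃ v : affineCone X, ∃ h : (fun i => (s i).1 v) ≠ 0,
    q = Projectivization.mk K (fun i => (s i).1 v) h}

/-- `rank-index(X, L^d) = k`, where `L = O_X(1)`: the space `H⁰(X, L^d)` is nonzero and finite
dimensional and, in the embedding of `X` by the complete linear series `|L^d|` (with respect to
any basis of sections), `k` is the smallest integer for which property `QR(k)` holds. In
particular the ideal of this embedding is generated by quadrics. -/
def HasRankIndex (X : Set (PSpace K r)) (d k : ℕ) : Prop :=
  (∃ N : ℕ, Nonempty (Module.Basis (Fin (N + 1)) K (sections X d))) ∧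
    ∀ (N : ℕ) (b : Module.Basis (Fin (N + 1)) K (sections X d)),
      IsLeast {i : ℕ | PropertyQR (imageBySections X b) i} k

end Varieties

/-!
Let `φ` send a form of degree `d` to the linear form of the ambient space which restricts to it, and
let `Q` be the ideal generated by the quadrics `φ(s²h) φ(t²h) - φ(sth)²`, with `s` and `t` linear.
These have rank at most three and vanish on the image of `X`; the point is that modulo `Q` the
product `φ(F) φ(G)` depends only on `FG`. Polarization yields three-term relations among the
splittings of a product of linear forms into two factors, and in characteristic `3` a count of the
splittings shows that any two linear factors may be exchanged between `F` and `G`. Hence `φ` extends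
to a multiplicative map on the subring generated by the forms of degree `d`. Modulo `Q` it inverts
the pull-back of polynomials from the ambient space, and, as the ideal of `X` is generated in
degrees at most `d`, it kills that ideal. So every polynomial vanishing on the image lies in `Q`.

Conversely, a quadric of rank at most two is a product of two linear forms, and no nonzero such
product vanishes on the image, because the ideal of `X` is prime; but for suitable `s`, `t` and `h`
the quadric `φ(s²h) φ(t²h) - φ(sth)²` is nonzero and does.
-/

section Exchange

variable {R S A : Type*} [CommRing R] [CommRing S] [CommRing A] [Algebra R S] [Algebra R A]

/-- The relations imposed on a linear map `φ` by the quadrics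
`Q(s, t, h) = φ(s²h) φ(t²h) - φ(sth)²` of rank at most three, for `s, t ∈ V` and `h ∈ U`. -/
def SquareExchange (φ : S →ₗ[R] A) (V U : Submodule R S) : Prop :=
  ∀ s ∈ V, ∀ t ∈ V, ∀ h ∈ U, φ (s ^ 2 * h) * φ (t ^ 2 * h) = φ (s * t * h) ^ 2

namespace SquareExchange

variable {φ : S →ₗ[R] A} {V U : Submodule R S}

theorem polarize_left (H : SquareExchange φ V U) {p q t h : S} (hp : p ∈ V) (hq : q ∈ V)
    (ht : t ∈ V) (hh : h ∈ U) :
    2 * (φ (p * q * h) * φ (t ^ 2 * h)) = 2 * (φ (p * t * h) * φ (q * t * h)) := by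
  have hpq := H (p + q) (V.add_mem hp hq) t ht h hh
  rw [show (p + q) ^ 2 * h = p ^ 2 * h + (p * q * h + p * q * h) + q ^ 2 * h by ring,
    show (p + q) * t * h = p * t * h + q * t * h by ring] at hpq
  simp only [map_add] at hpq
  linear_combination hpq - H p hp t ht h hh - H q hq t ht h hh

theorem sum_pairings_eq_zero (h3 : (3 : A) = 0) (H : SquareExchange φ V U) {p q u v h : S}
    (hp : p ∈ V) (hq : q ∈ V) (hu : u ∈ V) (hv : v ∈ V) (hh : h ∈ U) :
    φ (p * q * h) * φ (u * v * h) + φ (p * u * h) * φ (q * v * h)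
      + φ (p * v * h) * φ (q * u * h) = 0 := by
  have huv := H.polarize_left hp hq (V.add_mem hu hv) hh
  rw [show (u + v) ^ 2 * h = u ^ 2 * h + (u * v * h + u * v * h) + v ^ 2 * h by ring,
    show p * (u + v) * h = p * u * h + p * v * h by ring,
    show q * (u + v) * h = q * u * h + q * v * h by ring] at huv
  simp only [map_add] at huv
  linear_combination huv - H.polarize_left hp hq hu hh - H.polarize_left hp hq hv hh
    - (φ (p * q * h) * φ (u * v * h) - φ (p * u * h) * φ (q * v * h)
      - φ (p * v * h) * φ (q * u * h)) * h3

theorem sum_separating_eq_zero (h3 : (3 : A) = 0) (H : SquareExchange φ V U) {p q u v h k : S}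
    (hp : p ∈ V) (hq : q ∈ V) (hu : u ∈ V) (hv : v ∈ V) (hh : h ∈ U) (hk : k ∈ U) :
    φ (p * q * h) * φ (u * v * k) + φ (p * q * k) * φ (u * v * h)
      + φ (p * u * h) * φ (q * v * k) + φ (p * u * k) * φ (q * v * h)
      + φ (p * v * h) * φ (q * u * k) + φ (p * v * k) * φ (q * u * h) = 0 := by
  have hhk := H.sum_pairings_eq_zero h3 hp hq hu hv (U.add_mem hh hk)
  simp only [mul_add, map_add] at hhk
  linear_combination hhk - H.sum_pairings_eq_zero h3 hp hq hu hv hh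
    - H.sum_pairings_eq_zero h3 hp hq hu hv hk

/-- The right-hand side is the sum over all ten splittings of `x, p, q, y, u, v` into two triples.
Among the nine pairs separated by `{x, p, q} ⊔ {y, u, v}`, every other splitting separates
exactly five, so adding up `sum_separating_eq_zero` over these pairs gives `4 σ + 5 N = 0`. -/
theorem eq_sum_splittings (h3 : (3 : A) = 0) (H : SquareExchange φ V V) {x y p q u v : S}
    (hx : x ∈ V) (hy : y ∈ V) (hp : p ∈ V) (hq : q ∈ V) (hu : u ∈ V) (hv : v ∈ V) :
    φ (x * (p * q)) * φ (y * (u * v)) =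
      φ (x * (p * q)) * φ (y * (u * v)) + φ (x * (p * y)) * φ (q * (u * v))
        + φ (x * (p * u)) * φ (q * (y * v)) + φ (x * (p * v)) * φ (q * (y * u))
        + φ (x * (q * y)) * φ (p * (u * v)) + φ (x * (q * u)) * φ (p * (y * v))
        + φ (x * (q * v)) * φ (p * (y * u)) + φ (x * (y * u)) * φ (p * (q * v))
        + φ (x * (y * v)) * φ (p * (q * u)) + φ (x * (u * v)) * φ (p * (q * y)) := by
  generalize hσ : φ (x * (p * q)) * φ (y * (u * v)) = σ
  generalize hN : σ + φ (x * (p * y)) * φ (q * (u * v))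
    + φ (x * (p * u)) * φ (q * (y * v)) + φ (x * (p * v)) * φ (q * (y * u))
    + φ (x * (q * y)) * φ (p * (u * v)) + φ (x * (q * u)) * φ (p * (y * v))
    + φ (x * (q * v)) * φ (p * (y * u)) + φ (x * (y * u)) * φ (p * (q * v))
    + φ (x * (y * v)) * φ (p * (q * u)) + φ (x * (u * v)) * φ (p * (q * y)) = N
  have xy := H.sum_separating_eq_zero h3 hp hq hu hv hx hy
  have xu := H.sum_separating_eq_zero h3 hp hq hy hv hx hu
  have xv := H.sum_separating_eq_zero h3 hp hq hy hu hx hv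
  have py := H.sum_separating_eq_zero h3 hx hq hu hv hp hy
  have pu := H.sum_separating_eq_zero h3 hx hq hy hv hp hu
  have pv := H.sum_separating_eq_zero h3 hx hq hy hu hp hv
  have qy := H.sum_separating_eq_zero h3 hx hp hu hv hq hy
  have qu := H.sum_separating_eq_zero h3 hx hp hy hv hq hu
  have qv := H.sum_separating_eq_zero h3 hx hp hy hu hq hv
  have hsum : 4 * σ + 5 * N = 0 := by
    simp only [mul_comm, mul_left_comm] at xy xu xv py pu pv qy qu qv hσ hN ⊢
    linear_combination xy + xu + xv + py + pu + pv + qy + qu + qv - 9 * hσ - 5 * hN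
  linear_combination hsum - (σ + 2 * N) * h3

theorem swap_of_triple (h3 : (3 : A) = 0) (H : SquareExchange φ V V) {x y p q u v : S}
    (hx : x ∈ V) (hy : y ∈ V) (hp : p ∈ V) (hq : q ∈ V) (hu : u ∈ V) (hv : v ∈ V) :
    φ (x * (p * q)) * φ (y * (u * v)) = φ (y * (p * q)) * φ (x * (u * v)) := by
  rw [H.eq_sum_splittings h3 hx hy hp hq hu hv, H.eq_sum_splittings h3 hy hx hp hq hu hv]
  simp only [mul_comm, mul_left_comm]
  ring

theorem swap_of_mem_pow_two (h3 : (3 : A) = 0) (H : SquareExchange φ V V) {x y a b : S}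
    (hx : x ∈ V) (hy : y ∈ V) (ha : a ∈ V ^ 2) (hb : b ∈ V ^ 2) :
    φ (x * a) * φ (y * b) = φ (y * a) * φ (x * b) := by
  rw [pow_two] at ha hb
  induction ha using Submodule.mul_induction_on' with
  | add a _ a' _ iha iha' => simp only [mul_add, map_add, add_mul, iha, iha']
  | mem_mul_mem p hp q hq =>
    induction hb using Submodule.mul_induction_on' with
    | add b _ b' _ ihb ihb' => simp only [mul_add, map_add, ihb, ihb']
    | mem_mul_mem u hu v hv => exact H.swap_of_triple h3 hx hy hp hq hu hv

theorem comp_mulLeft {n : ℕ} (H : SquareExchange φ V (V ^ (n + 1))) {z : S} (hz : z ∈ V) :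
    SquareExchange (φ ∘ₗ LinearMap.mulLeft R z) V (V ^ n) := by
  intro s hs t ht h hh
  have hzh : z * h ∈ V ^ (n + 1) := pow_succ' V n ▸ Submodule.mul_mem_mul hz hh
  simpa only [LinearMap.comp_apply, LinearMap.mulLeft_apply, mul_left_comm z]
    using H s hs t ht _ hzh

/-- Let `D(a, b)` be the difference of the two sides. By induction `D(za, zb) = 0`, so
`D(za, z'z''b) = -D(z'a, zz''b)`. Three such steps permute `z, z', z''` cyclically and give
`D(za, z'z''b) = -D(za, z'z''b)`, whence `D = 0` as `3 = 0`. -/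
theorem swap (h3 : (3 : A) = 0) {n : ℕ} (H : SquareExchange φ V (V ^ (n + 1))) {x y a b : S}
    (hx : x ∈ V) (hy : y ∈ V) (ha : a ∈ V ^ (n + 2)) (hb : b ∈ V ^ (n + 2)) :
    φ (x * a) * φ (y * b) = φ (y * a) * φ (x * b) := by
  induction n generalizing φ a b with
  | zero => exact swap_of_mem_pow_two h3 (by simpa using H) hx hy ha hb
  | succ n ih =>
    have hdiag {z a b : S} (hz : z ∈ V) (ha : a ∈ V ^ (n + 2)) (hb : b ∈ V ^ (n + 2)) :
        φ (x * (z * a)) * φ (y * (z * b)) = φ (y * (z * a)) * φ (x * (z * b)) := by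
      simpa only [LinearMap.comp_apply, LinearMap.mulLeft_apply, mul_left_comm z]
        using ih (H.comp_mulLeft hz) ha hb
    have hpolar {z w a b : S} (hz : z ∈ V) (hw : w ∈ V) (ha : a ∈ V ^ (n + 2))
        (hb : b ∈ V ^ (n + 2)) :
        φ (x * (z * a)) * φ (y * (w * b)) + φ (x * (w * a)) * φ (y * (z * b)) =
          φ (y * (z * a)) * φ (x * (w * b)) + φ (y * (w * a)) * φ (x * (z * b)) := by
      have hzw := hdiag (V.add_mem hz hw) ha hb
      simp only [add_mul, mul_add, map_add] at hzw
      linear_combination hzw - hdiag hz ha hb - hdiag hw ha hb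
    rw [pow_succ'] at ha
    rw [pow_succ', pow_succ' V (n + 1)] at hb
    induction ha using Submodule.mul_induction_on' with
    | add a _ a' _ iha iha' => simp only [mul_add, map_add, add_mul, iha, iha']
    | mem_mul_mem z hz a ha =>
      induction hb using Submodule.mul_induction_on' with
      | add b _ b' _ ihb ihb' => simp only [mul_add, map_add, ihb, ihb']
      | mem_mul_mem z' hz' b hb =>
        induction hb using Submodule.mul_induction_on' with
        | add b _ b' _ ihb ihb' => simp only [mul_add, map_add, ihb, ihb']
        | mem_mul_mem z'' hz'' b hb =>
          have hmem {w : S} (hw : w ∈ V) : w * b ∈ V ^ (n + 2) :=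
            pow_succ' V (n + 1) ▸ Submodule.mul_mem_mul hw hb
          have e := hpolar hz hz' ha (hmem hz'')
          have e' := hpolar hz' hz'' ha (hmem hz)
          have e'' := hpolar hz'' hz ha (hmem hz')
          rw [mul_left_comm z'' z, mul_left_comm z' z] at e'
          rw [mul_left_comm z'' z'] at e''
          linear_combination -e + e' - e'' + (φ (x * (z * a)) * φ (y * (z' * (z'' * b))) -
            φ (y * (z * a)) * φ (x * (z' * (z'' * b)))) * h3

end SquareExchange

end Exchange

section MonomialExchange

variable {σ A : Type*} [CommSemiring A]

/-- The relations `μ(a + i) ν(b + j) = μ(a + j) ν(b + i)` between two functions on exponents, where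
the total exponents `a + i` and `b + j` have degrees `d` and `e`. -/
def MonomialExchange (μ ν : (σ →₀ ℕ) → A) (d e : ℕ) : Prop :=
  ∀ (i j : σ) (a b : σ →₀ ℕ), a.degree + 1 = d → b.degree + 1 = e →
    μ (a + Finsupp.single i 1) * ν (b + Finsupp.single j 1) =
      μ (a + Finsupp.single j 1) * ν (b + Finsupp.single i 1)

theorem exists_add_single_of_degree_eq_succ {α : σ →₀ ℕ} {n : ℕ} (hα : α.degree = n + 1) :
    ∃ (β : σ →₀ ℕ) (i : σ), β.degree = n ∧ α = β + Finsupp.single i 1 := by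
  obtain ⟨β, hβα, hβ⟩ := α.exists_le_degree_eq n (by omega)
  obtain ⟨γ, rfl⟩ := le_iff_exists_add.1 hβα
  rw [map_add, hβ, Nat.add_left_cancel_iff] at hα
  obtain ⟨i, rfl⟩ : γ ∈ Set.range fun i => Finsupp.single i 1 := Finsupp.range_single_one ▸ hα
  exact ⟨β, i, hβ, rfl⟩

theorem exists_common_refinement {α β α' β' : σ →₀ ℕ} (h : α + β = α' + β') :
    ∃ a a' b c, α = c + a ∧ α' = c + a' ∧ β = b + a' ∧ β' = b + a := by
  refine ⟨α - α', α' - α, β - (α' - α), α ⊓ α', ?_, ?_, ?_, ?_⟩ <;>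
  · ext i
    have := DFunLike.congr_fun h i
    simp only [Finsupp.add_apply, Finsupp.tsub_apply, Finsupp.inf_apply] at this ⊢
    omega

namespace MonomialExchange

variable {μ ν : (σ →₀ ℕ) → A} {d e : ℕ}

theorem swap (H : MonomialExchange μ ν d e) {n : ℕ} {a a' b c : σ →₀ ℕ} (ha : a.degree = n)
    (ha' : a'.degree = n) (hc : c.degree + n = d) (hb : b.degree + n = e) :
    μ (c + a) * ν (b + a') = μ (c + a') * ν (b + a) := by
  induction n generalizing a a' b c with
  | zero => rw [(Finsupp.degree_eq_zero_iff a).1 ha, (Finsupp.degree_eq_zero_iff a').1 ha']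
  | succ n ih =>
    obtain ⟨a, i, han, rfl⟩ := exists_add_single_of_degree_eq_succ ha
    obtain ⟨a', j, han', rfl⟩ := exists_add_single_of_degree_eq_succ ha'
    calc
      _ = μ (c + a + Finsupp.single i 1) * ν (b + a' + Finsupp.single j 1) := by
        simp only [add_assoc]
      _ = μ (c + a + Finsupp.single j 1) * ν (b + a' + Finsupp.single i 1) :=
        H i j _ _ (by rw [map_add]; omega) (by rw [map_add]; omega)
      _ = μ (c + Finsupp.single j 1 + a) * ν (b + Finsupp.single i 1 + a') := by
        simp only [add_right_comm]
      _ = μ (c + Finsupp.single j 1 + a') * ν (b + Finsupp.single i 1 + a) :=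
        ih han han' (by rw [map_add, Finsupp.degree_single]; omega)
          (by rw [map_add, Finsupp.degree_single]; omega)
      _ = _ := by simp only [add_right_comm, add_assoc]

theorem mul_eq_mul_of_add_eq_add (H : MonomialExchange μ ν d e) {α β α' β' : σ →₀ ℕ}
    (hα : α.degree = d) (hβ : β.degree = e) (hα' : α'.degree = d) (h : α + β = α' + β') :
    μ α * ν β = μ α' * ν β' := by
  obtain ⟨a, a', b, c, rfl, rfl, rfl, rfl⟩ := exists_common_refinement h
  rw [map_add] at hα hα' hβ
  exact H.swap rfl (by omega) hα (by omega)

end MonomialExchange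

open Classical in
/-- The extension of a function `μ` on exponents of degree `d` to all exponents by splitting off
parts of degree `d`. It is zero when a remainder of positive degree less than `d` is left. The
parts are arbitrary choices, which do not matter when `μ` satisfies `MonomialExchange`. -/
noncomputable def multiplicativeExtension (μ : (σ →₀ ℕ) → A) (d : ℕ) (γ : σ →₀ ℕ) : A :=
  if γ = 0 then 1
  else if h : ∃ α ≤ γ, α ≠ 0 ∧ α.degree = d then
    μ h.choose * multiplicativeExtension μ d (γ - h.choose)
  else 0
termination_by γ.degree
decreasing_by
  have hα := (Finsupp.degree_eq_zero_iff h.choose).not.2 h.choose_spec.2.1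
  have hγ := congrArg Finsupp.degree (tsub_add_cancel_of_le h.choose_spec.1)
  rw [map_add] at hγ
  omega

variable {μ : (σ →₀ ℕ) → A} {d : ℕ}

theorem multiplicativeExtension_zero : multiplicativeExtension μ d 0 = 1 := by
  rw [multiplicativeExtension, if_pos rfl]

theorem multiplicativeExtension_eq_zero {γ : σ →₀ ℕ} (hγ : 0 < γ.degree) (hγd : γ.degree < d) :
    multiplicativeExtension μ d γ = 0 := by
  rw [multiplicativeExtension, if_neg, dif_neg]
  · rintro ⟨α, hαγ, -, rfl⟩
    exact (Finsupp.degree_mono hαγ).not_gt hγd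
  · rintro rfl
    exact hγ.ne' (map_zero _)

theorem exists_multiplicativeExtension_eq_mul (hd : d ≠ 0) {γ : σ →₀ ℕ} (hγ : d ≤ γ.degree) :
    ∃ α β, γ = α + β ∧ α.degree = d ∧
      multiplicativeExtension μ d γ = μ α * multiplicativeExtension μ d β := by
  have h : ∃ α ≤ γ, α ≠ 0 ∧ α.degree = d := by
    obtain ⟨α, hαγ, rfl⟩ := γ.exists_le_degree_eq d hγ
    exact ⟨α, hαγ, (Finsupp.degree_eq_zero_iff α).not.1 hd, rfl⟩
  refine ⟨h.choose, γ - h.choose, (add_tsub_cancel_of_le h.choose_spec.1).symm,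
    h.choose_spec.2.2, ?_⟩
  rw [multiplicativeExtension, if_neg, dif_pos h]
  rintro rfl
  exact hd (Nat.le_zero.1 (hγ.trans_eq (map_zero _)))

namespace MonomialExchange

theorem multiplicativeExtension_add (H : MonomialExchange μ μ d d) (hd : d ≠ 0) {α : σ →₀ ℕ}
    (hα : α.degree = d) (β : σ →₀ ℕ) :
    multiplicativeExtension μ d (α + β) = μ α * multiplicativeExtension μ d β := by
  induction hn : β.degree using Nat.strong_induction_on generalizing α β with
  | _ n ih =>
    obtain ⟨α', β', hαβ, hα', h⟩ := exists_multiplicativeExtension_eq_mul (μ := μ) hd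
      (γ := α + β) (by rw [map_add]; omega)
    suffices hμ : MonomialExchange μ (multiplicativeExtension μ d) d n by
      rw [h, hμ.mul_eq_mul_of_add_eq_add hα hn hα' hαβ]
    intro i j a b ha hb
    by_cases hbd : d ≤ b.degree + 1
    · obtain ⟨b, b', rfl, hb'⟩ : ∃ b₁ b₂, b = b₁ + b₂ ∧ b₁.degree + 1 = d := by
        obtain ⟨b₁, hb₁, hb₁d⟩ := b.exists_le_degree_eq (d - 1) (by omega)
        exact ⟨b₁, b - b₁, (add_tsub_cancel_of_le hb₁).symm, by omega⟩
      have hsplit (k : σ) : multiplicativeExtension μ d (b + b' + Finsupp.single k 1) =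
          μ (b + Finsupp.single k 1) * multiplicativeExtension μ d b' := by
        rw [add_right_comm]
        rw [map_add] at hb
        exact ih b'.degree (by omega) (by rw [map_add, Finsupp.degree_single, hb']) b' rfl
      rw [hsplit, hsplit, ← mul_assoc, ← mul_assoc, H i j a b ha hb']
    · have hzero (k : σ) : multiplicativeExtension μ d (b + Finsupp.single k 1) = 0 :=
        multiplicativeExtension_eq_zero (by rw [map_add, Finsupp.degree_single]; omega)
          (by rw [map_add, Finsupp.degree_single]; omega)
      rw [hzero, hzero, mul_zero, mul_zero]

end MonomialExchange

end MonomialExchange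

section PolynomialExtension

open MvPolynomial

variable {σ K A : Type*} [CommRing K] [CommRing A] [Algebra K A] {d : ℕ}

theorem SquareExchange.monomialExchange (h3 : (3 : A) = 0) (hd : 3 ≤ d)
    {φ : MvPolynomial σ K →ₗ[K] A}
    (H : SquareExchange φ (homogeneousSubmodule σ K 1) (homogeneousSubmodule σ K (d - 2))) :
    MonomialExchange (fun α => φ (monomial α 1)) (fun α => φ (monomial α 1)) d d := by
  obtain ⟨n, rfl⟩ := Nat.exists_eq_add_of_le' hd
  intro i j a b ha hb
  have hmem {c : σ →₀ ℕ} (hc : c.degree + 1 = n + 3) :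
      monomial c (1 : K) ∈ homogeneousSubmodule σ K 1 ^ (n + 2) := by
    rw [homogeneousSubmodule_one_pow]
    exact isHomogeneous_monomial 1 (by omega)
  have hswap := swap h3 (n := n) (by rwa [homogeneousSubmodule_one_pow]) (isHomogeneous_X K i)
    (isHomogeneous_X K j) (hmem ha) (hmem hb)
  simpa only [X, monomial_mul, one_mul, add_comm (Finsupp.single _ 1)] using hswap

theorem homogeneousSubmodule_eq_span_monomial :
    homogeneousSubmodule σ K d =
      Submodule.span K ((fun α => monomial α 1) '' {α | α.degree = d}) :=
  (homogeneousSubmodule_eq_finsupp_supported σ K d).trans (restrictSupport_eq_span K _)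

/-- On the subring generated by the forms of degree `d`, the linear map `Ψ` is multiplicative and
extends the restriction of `φ` to those forms. It vanishes on forms of smaller positive degree. -/
structure IsMultiplicativeExtension (φ Ψ : MvPolynomial σ K →ₗ[K] A) (d : ℕ) : Prop where
  apply_one : Ψ 1 = 1
  apply_mul {F : MvPolynomial σ K} (hF : F.IsHomogeneous d) (G : MvPolynomial σ K) :
    Ψ (F * G) = φ F * Ψ G
  apply_eq_zero {e : ℕ} {F : MvPolynomial σ K} (hF : F.IsHomogeneous e) (he : 0 < e) (hed : e < d) :
    Ψ F = 0

theorem MonomialExchange.exists_isMultiplicativeExtension {φ : MvPolynomial σ K →ₗ[K] A}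
    (hd : d ≠ 0)
    (H : MonomialExchange (fun α => φ (monomial α 1)) (fun α => φ (monomial α 1)) d d) :
    ∃ Ψ : MvPolynomial σ K →ₗ[K] A, IsMultiplicativeExtension φ Ψ d := by
  set ψ := multiplicativeExtension (fun α => φ (monomial α 1)) d
  let Ψ := (basisMonomials σ K).constr K ψ
  have hΨ (α : σ →₀ ℕ) : Ψ (monomial α 1) = ψ α := by
    rw [← (basisMonomials σ K).constr_basis K ψ α, coe_basisMonomials]
  refine ⟨Ψ, (hΨ 0).trans multiplicativeExtension_zero, fun {F} hF G => ?_,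
    fun {e F} hF he hed => ?_⟩
  · have hbilin : homogeneousSubmodule σ K d ≤ LinearMap.eqLocus
        (Ψ ∘ₗ LinearMap.mulRight K G) (LinearMap.mulRight K (Ψ G) ∘ₗ φ) := by
      rw [homogeneousSubmodule_eq_span_monomial, Submodule.span_le]
      rintro _ ⟨α, hα, rfl⟩
      suffices Ψ ∘ₗ LinearMap.mulLeft K (monomial α 1) =
          LinearMap.mulLeft K (φ (monomial α 1)) ∘ₗ Ψ from LinearMap.congr_fun this G
      refine (basisMonomials σ K).ext fun β => ?_
      simp only [coe_basisMonomials, LinearMap.comp_apply, LinearMap.mulLeft_apply, monomial_mul,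
        one_mul, hΨ]
      exact H.multiplicativeExtension_add hd hα β
    exact hbilin hF
  · have hker : homogeneousSubmodule σ K e ≤ LinearMap.ker Ψ := by
      rw [homogeneousSubmodule_eq_span_monomial, Submodule.span_le]
      rintro _ ⟨α, rfl, rfl⟩
      exact (hΨ α).trans (multiplicativeExtension_eq_zero he hed)
    exact hker hF

namespace IsMultiplicativeExtension

section Ring

variable {σ ι K A : Type*} [CommRing K] [CommRing A] [Algebra K A] {d : ℕ}
  {φ Ψ : MvPolynomial σ K →ₗ[K] A}

theorem apply_aeval (H : IsMultiplicativeExtension φ Ψ d) {f : ι → MvPolynomial σ K}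
    (hf : ∀ i, (f i).IsHomogeneous d) {x : ι → A} (hx : ∀ i, φ (f i) = x i)
    (P : MvPolynomial ι K) : Ψ (aeval f P) = aeval x P := by
  induction P using MvPolynomial.induction_on with
  | C c => simp only [algHom_C, Algebra.algebraMap_eq_smul_one, map_smul, H.apply_one]
  | add P Q hP hQ => simp only [map_add, hP, hQ]
  | mul_X P i hP =>
    rw [map_mul, aeval_X, mul_comm, H.apply_mul (hf i), hP, hx, map_mul, aeval_X,
      mul_comm]

end Ring

section Field

variable {σ K A : Type*} [Field K] [CommRing A] [Algebra K A] {d : ℕ}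
  {φ Ψ : MvPolynomial σ K →ₗ[K] A} {I : Ideal (MvPolynomial σ K)}

theorem apply_mul_eq_zero_of_isHomogeneous (H : IsMultiplicativeExtension φ Ψ d) (hI : I ≠ ⊤)
    (hφ : ∀ F ∈ I, F.IsHomogeneous d → φ F = 0) {F : MvPolynomial σ K} (hF : F ∈ I) {e : ℕ}
    (hFe : F.IsHomogeneous e) (hed : e ≤ d) (G : MvPolynomial σ K) : Ψ (G * F) = 0 := by
  induction G using MvPolynomial.induction_on' with
  | add P Q hP hQ => rw [add_mul, map_add, hP, hQ, add_zero]
  | monomial β c =>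
    rcases le_or_gt d (β.degree + e) with hβ | hβ
    · obtain ⟨γ, hγβ, hγ⟩ := β.exists_le_degree_eq (d - e) (by omega)
      obtain ⟨δ, rfl⟩ := le_iff_exists_add.1 hγβ
      have hhom : (monomial γ 1 * F).IsHomogeneous d :=
        Nat.sub_add_cancel hed ▸ (isHomogeneous_monomial 1 hγ).mul hFe
      rw [show monomial (γ + δ) c * F = monomial γ 1 * F * monomial δ c by
        rw [mul_right_comm, monomial_mul, one_mul], H.apply_mul hhom,
        hφ _ (I.mul_mem_left _ hF) hhom, zero_mul]
    · rcases Nat.eq_zero_or_pos (β.degree + e) with h0 | hpos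
      · obtain rfl : e = 0 := by omega
        obtain ⟨a, rfl⟩ : ∃ a, F = C a :=
          ⟨_, (homogeneousComponent_eq_self hFe).symm.trans (homogeneousComponent_zero F)⟩
        have ha : a = 0 := by
          by_contra ha
          exact hI (I.eq_top_of_isUnit_mem hF ((isUnit_iff_ne_zero.2 ha).map C))
        rw [ha, C_0, mul_zero, map_zero]
      · exact H.apply_eq_zero ((isHomogeneous_monomial c rfl).mul hFe) hpos hβ

theorem apply_eq_zero_of_mem (H : IsMultiplicativeExtension φ Ψ d) (hI : I ≠ ⊤)
    (hgen : I = Ideal.span {F | F ∈ I ∧ ∃ e ≤ d, F.IsHomogeneous e})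
    (hφ : ∀ F ∈ I, F.IsHomogeneous d → φ F = 0) {F : MvPolynomial σ K} (hF : F ∈ I) : Ψ F = 0 := by
  suffices ∀ G, Ψ (G * F) = 0 by simpa only [one_mul] using this 1
  rw [hgen] at hF
  induction hF using Submodule.span_induction with
  | zero => simp only [mul_zero, map_zero, implies_true]
  | add F F' _ _ hF hF' => intro G; rw [mul_add, map_add, hF, hF', add_zero]
  | smul P F _ hF => intro G; rw [smul_eq_mul, ← mul_assoc, hF]
  | mem F hF =>
    obtain ⟨hFI, e, hed, hFe⟩ := hF
    exact H.apply_mul_eq_zero_of_isHomogeneous hI hφ hFI hFe hed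

end Field

end IsMultiplicativeExtension

theorem comap_aeval_le {σ ι K : Type*} [Field K] (h3 : (3 : K) = 0) {d : ℕ} (hd : 3 ≤ d)
    {f : ι → MvPolynomial σ K} (hf : ∀ i, (f i).IsHomogeneous d)
    {φ : MvPolynomial σ K →ₗ[K] MvPolynomial ι K} (hφf : ∀ i, φ (f i) = X i)
    {Q : Ideal (MvPolynomial ι K)}
    (hφQ : ∀ s t h : MvPolynomial σ K, s.IsHomogeneous 1 → t.IsHomogeneous 1 →
      h.IsHomogeneous (d - 2) → φ (s ^ 2 * h) * φ (t ^ 2 * h) - φ (s * t * h) ^ 2 ∈ Q)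
    {I : Ideal (MvPolynomial σ K)} (hI : I ≠ ⊤)
    (hgen : I = Ideal.span {F | F ∈ I ∧ ∃ e ≤ d, F.IsHomogeneous e})
    (hφI : ∀ F ∈ I, F.IsHomogeneous d → φ F ∈ Q) : I.comap (aeval f) ≤ Q := by
  have h3Q : (3 : MvPolynomial ι K ⧸ Q) = 0 := by
    simpa only [map_ofNat, map_zero] using congrArg (algebraMap K (MvPolynomial ι K ⧸ Q)) h3
  let π := Ideal.Quotient.mkₐ K Q
  have hsq : SquareExchange (π.toLinearMap ∘ₗ φ) (homogeneousSubmodule σ K 1)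
      (homogeneousSubmodule σ K (d - 2)) := fun s hs t ht h hh => by
    exact (Ideal.Quotient.mk_eq_mk_iff_sub_mem _ _).2 (hφQ s t h hs ht hh)
  obtain ⟨Ψ, hΨ⟩ :=
    (hsq.monomialExchange h3Q hd).exists_isMultiplicativeExtension (by omega)
  intro P hP
  have hmk : Ψ (aeval f P) = π P := by
    rw [hΨ.apply_aeval hf (x := fun i => π (X i)) fun i => congrArg π (hφf i), ← comp_aeval_apply,
      aeval_X_left_apply]
  rw [← Ideal.Quotient.eq_zero_iff_mem, ← Ideal.Quotient.mkₐ_eq_mk K, ← hmk]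
  exact hΨ.apply_eq_zero_of_mem hI hgen
    (fun F hF hFd => Ideal.Quotient.eq_zero_iff_mem.2 (hφI F hF hFd)) hP

end PolynomialExtension

section Quadrics

open MvPolynomial

section LinearForm

variable (R ι : Type*) [CommRing R] [Fintype ι]

/-- The linear form `∑ aᵢ Xᵢ` with coefficient vector `a`. -/
noncomputable def linearForm : (ι → R) →ₗ[R] MvPolynomial ι R :=
  Fintype.linearCombination R X

/-- The quadratic form `∑ Aᵢⱼ Xᵢ Xⱼ` of a matrix `A`, which need not be symmetric. -/
noncomputable def quadric : Matrix ι ι R →ₗ[R] MvPolynomial ι R where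
  toFun A := ∑ i, ∑ j, C (A i j) * (X i * X j)
  map_add' A B := by simp only [Matrix.add_apply, C_add, add_mul, Finset.sum_add_distrib]
  map_smul' c A := by
    simp only [Matrix.smul_apply, smul_eq_mul, C_mul, mul_assoc, Finset.smul_sum, smul_eq_C_mul,
      RingHom.id_apply]

variable {R ι}

theorem linearForm_apply (a : ι → R) : linearForm R ι a = ∑ i, C (a i) * X i := by
  simp only [linearForm, Fintype.linearCombination_apply, smul_eq_C_mul]

theorem quadric_apply (A : Matrix ι ι R) :
    quadric R ι A = ∑ i, ∑ j, C (A i j) * (X i * X j) := rfl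

theorem eval_linearForm (a x : ι → R) : eval x (linearForm R ι a) = a ⬝ᵥ x := by
  simp only [linearForm_apply, map_sum, map_mul, eval_C, eval_X, dotProduct]

theorem isHomogeneous_linearForm (a : ι → R) : (linearForm R ι a).IsHomogeneous 1 := by
  rw [linearForm_apply]
  exact IsHomogeneous.sum _ _ _ fun i _ => (isHomogeneous_X R i).C_mul (a i)

theorem linearForm_injective : Function.Injective (linearForm R ι) := by
  classical
  intro a b h
  funext i
  simpa only [eval_linearForm, dotProduct_single_one] using congrArg (eval (Pi.single i 1)) h

theorem quadric_vecMulVec (a b : ι → R) :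
    quadric R ι (Matrix.vecMulVec a b) = linearForm R ι a * linearForm R ι b := by
  simp only [linearForm_apply, quadric_apply, Finset.sum_mul_sum, Matrix.vecMulVec_apply, C_mul,
    mul_mul_mul_comm]

theorem quadric_transpose_mul_mul {κ : Type*} [Fintype κ] (P : Matrix κ ι R) (M : Matrix κ κ R) :
    quadric R ι (P.transpose * M * P) =
      ∑ k, ∑ l, C (M k l) * (linearForm R ι (P k) * linearForm R ι (P l)) := by
  have hsum : P.transpose * M * P = ∑ k, ∑ l, M k l • Matrix.vecMulVec (P k) (P l) := by
    ext i j
    simp only [Matrix.mul_apply, Matrix.transpose_apply, Matrix.sum_apply, Matrix.smul_apply,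
      Matrix.vecMulVec_apply, smul_eq_mul, Finset.sum_mul]
    rw [Finset.sum_comm]
    exact Finset.sum_congr rfl fun k _ => Finset.sum_congr rfl fun l _ => by ring
  simp only [hsum, map_sum, map_smul, quadric_vecMulVec, smul_eq_C_mul]

end LinearForm

variable {K ι : Type*} [Field K] [Fintype ι] {N : ℕ}

theorem exists_isQuadricOfRank_mul_sub_sq [NeZero (2 : K)] (a b c : Fin (N + 1) → K) :
    ∃ ρ ≤ 3, IsQuadricOfRank
      (linearForm K _ a * linearForm K _ b - linearForm K _ c ^ 2) ρ := by
  let P : Matrix (Fin 3) (Fin (N + 1)) K := ![a, b, c]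
  let M : Matrix (Fin 3) (Fin 3) K := !![0, 2⁻¹, 0; 2⁻¹, 0, 0; 0, 0, -1]
  have hM : M.transpose = M := by ext i j; fin_cases i <;> fin_cases j <;> rfl
  refine ⟨(P.transpose * M * P).rank, (Matrix.rank_mul_le_right _ P).trans P.rank_le_height,
    P.transpose * M * P, ?_, rfl, ?_⟩
  · rw [Matrix.IsSymm, Matrix.transpose_mul, Matrix.transpose_mul, Matrix.transpose_transpose, hM,
      Matrix.mul_assoc]
  · have hhalf : (C 2⁻¹ * 2 : MvPolynomial (Fin (N + 1)) K) = 1 := by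
      rw [← map_ofNat C 2, ← C_mul, inv_mul_cancel₀ two_ne_zero, C_1]
    rw [← quadric_apply, quadric_transpose_mul_mul]
    simp only [M, P, Fin.sum_univ_three, Matrix.of_apply, Matrix.cons_val', Matrix.cons_val_fin_one,
      Matrix.cons_val_zero, Matrix.cons_val_one, Matrix.cons_val, C_0, C_neg, C_1]
    linear_combination (-linearForm K _ a * linearForm K _ b) * hhalf

theorem exists_eq_transpose_mul_mul_of_isSymm {A : Matrix ι ι K} (hA : A.IsSymm) {ρ : ℕ}
    (hρ : A.rank = ρ) :
    ∃ (P : Matrix (Fin ρ) ι K) (M : Matrix (Fin ρ) (Fin ρ) K), A = P.transpose * M * P := by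
  classical
  let e : LinearMap.range A.mulVecLin ≃ₗ[K] (Fin ρ → K) :=
    (Module.finBasisOfFinrankEq K _ hρ).equivFun
  let f : (ι → K) →ₗ[K] (Fin ρ → K) := e.toLinearMap ∘ₗ A.mulVecLin.rangeRestrict
  obtain ⟨g, hg⟩ := f.exists_rightInverse_of_surjective
    (LinearMap.range_eq_top.2 (e.surjective.comp A.mulVecLin.surjective_rangeRestrict))
  let P := f.toMatrix'
  let U := g.toMatrix'
  have hAP : A = A * U * P := by
    have hgf : A.mulVecLin ∘ₗ g ∘ₗ f = A.mulVecLin := LinearMap.ext fun x =>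
      congrArg Subtype.val (e.injective (LinearMap.congr_fun hg (f x)))
    have := congrArg LinearMap.toMatrix' hgf
    rwa [LinearMap.toMatrix'_comp, LinearMap.toMatrix'_comp, ← Matrix.toLin'_apply',
      LinearMap.toMatrix'_toLin', ← Matrix.mul_assoc, eq_comm] at this
  have hAU : A * U = P.transpose * (U.transpose * A * U) := by
    nth_rw 1 [← hA.eq, hAP]
    simp only [Matrix.transpose_mul, hA.eq, Matrix.mul_assoc]
  exact ⟨P, U.transpose * A * U, by rwa [← hAU]⟩

theorem exists_mul_eq_quadratic [IsAlgClosed K] (α β γ : K) :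
    ∃ a b c d : K, a * c = α ∧ a * d + b * c = β ∧ b * d = γ := by
  by_cases hα : α = 0
  · exact ⟨0, 1, β, γ, by simp [hα], by simp, by simp⟩
  · obtain ⟨x, hx⟩ := IsAlgClosed.exists_root
      (Polynomial.C α * Polynomial.X ^ 2 + Polynomial.C β * Polynomial.X + Polynomial.C γ)
      (by rw [Polynomial.degree_quadratic hα]; decide)
    simp only [Polynomial.IsRoot, Polynomial.eval_add, Polynomial.eval_mul, Polynomial.eval_C,
      Polynomial.eval_pow, Polynomial.eval_X] at hx
    exact ⟨1, -x, α, β + α * x, by ring, by ring, by linear_combination -hx⟩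

theorem IsQuadricOfRank.exists_eq_mul [IsAlgClosed K] {q : MvPolynomial (Fin (N + 1)) K} {ρ : ℕ}
    (hq : IsQuadricOfRank q ρ) (hρ : ρ ≤ 2) :
    ∃ a b : Fin (N + 1) → K, q = linearForm K _ a * linearForm K _ b := by
  obtain ⟨A, hA, hrank, rfl⟩ := hq
  obtain ⟨P, M, hPM⟩ := exists_eq_transpose_mul_mul_of_isSymm hA hrank
  rw [← quadric_apply, hPM, quadric_transpose_mul_mul]
  clear hPM hrank
  interval_cases ρ
  · exact ⟨0, 0, by simp⟩
  · refine ⟨M 0 0 • P 0, P 0, ?_⟩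
    simp only [Fin.sum_univ_one, map_smul, smul_eq_C_mul, mul_assoc]
  · obtain ⟨a, b, c, d, hac, hadbc, hbd⟩ :=
      exists_mul_eq_quadratic (M 0 0) (M 0 1 + M 1 0) (M 1 1)
    refine ⟨a • P 0 + b • P 1, c • P 0 + d • P 1, ?_⟩
    replace hadbc := congrArg (C (σ := Fin (N + 1))) hadbc
    simp only [Fin.sum_univ_two, map_add, map_smul, smul_eq_C_mul, ← hac, ← hbd, C_mul] at hadbc ⊢
    linear_combination (-linearForm K _ (P 0) * linearForm K _ (P 1)) * hadbc

end Quadrics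

section Cone

open MvPolynomial

variable {K : Type*} [Field K] {r : ℕ} {X : Set (PSpace K r)}

theorem eval_smul_of_isHomogeneous {σ R : Type*} [CommSemiring R] {F : MvPolynomial σ R} {e : ℕ}
    (hF : F.IsHomogeneous e) (t : R) (v : σ → R) : eval (t • v) F = t ^ e * eval v F := by
  rw [eval_eq, eval_eq, Finset.mul_sum]
  refine Finset.sum_congr rfl fun α hα => ?_
  have hdeg : α.degree = e := by
    rw [Finsupp.degree_eq_weight_one]
    exact hF (mem_support_iff.1 hα)
  simp only [Pi.smul_apply, smul_eq_mul, mul_pow, Finset.prod_mul_distrib]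
  rw [Finset.prod_pow_eq_pow_sum, ← Finsupp.degree_apply, hdeg, mul_left_comm]

theorem smul_mem_affineCone {v : Fin (r + 1) → K} (hv : v ∈ affineCone X) {t : K} (ht : t ≠ 0) :
    t • v ∈ affineCone X := by
  obtain ⟨h, hX⟩ := hv
  refine ⟨smul_ne_zero ht h, ?_⟩
  rwa [(Projectivization.mk_eq_mk_iff' K _ _ (smul_ne_zero ht h) h).2 ⟨t, rfl⟩]

theorem mem_homogeneousIdeal {F : MvPolynomial (Fin (r + 1)) K} :
    F ∈ homogeneousIdeal X ↔ ∀ v ∈ affineCone X, eval v F = 0 := Iff.rfl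

theorem restrictForms_eq_zero_iff {d : ℕ} {F : homogeneousSubmodule (Fin (r + 1)) K d} :
    restrictForms X d F = 0 ↔ F.1 ∈ homogeneousIdeal X :=
  ⟨fun h v hv => congrFun (congrArg Subtype.val h) ⟨v, hv⟩,
    fun h => Subtype.ext (funext fun v => h v v.2)⟩

theorem sections_apply_smul {d : ℕ} (s : sections X d) (v : affineCone X) {t : K} (ht : t ≠ 0) :
    s.1 ⟨t • v.1, smul_mem_affineCone v.2 ht⟩ = t ^ d * s.1 v := by
  obtain ⟨e, F, G, hF, hG, hv, hs⟩ := s.2 v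
  have hte : t ^ e ≠ 0 := pow_ne_zero e ht
  have htv : eval (t • v.1) G ≠ 0 := by
    rw [eval_smul_of_isHomogeneous hG]
    exact mul_ne_zero hte hv
  rw [hs v hv, hs ⟨t • v.1, _⟩ htv, eval_smul_of_isHomogeneous hF, eval_smul_of_isHomogeneous hG,
    pow_add, mul_assoc, mul_div_mul_left _ _ hte, mul_div_assoc]

theorem eval_homogeneousComponent_eq_zero [Infinite K] {σ : Type*} {F : MvPolynomial σ K}
    {v : σ → K} (h : ∀ t : K, t ≠ 0 → eval (t • v) F = 0) (i : ℕ) :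
    eval v (homogeneousComponent i F) = 0 := by
  let p : Polynomial K := ∑ j ∈ Finset.range (F.totalDegree + 1),
    Polynomial.monomial j (eval v (homogeneousComponent j F))
  have hp : p = 0 := by
    refine p.eq_zero_of_infinite_isRoot ((Set.finite_singleton (0 : K)).infinite_compl.mono ?_)
    intro t ht
    rw [Set.mem_ofPred_eq, Polynomial.IsRoot, ← h t ht]
    conv_rhs => rw [← sum_homogeneousComponent F, map_sum]
    simp only [p, Polynomial.eval_finsetSum, Polynomial.eval_monomial, mul_comm,
      eval_smul_of_isHomogeneous (homogeneousComponent_isHomogeneous _ F)]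
  rcases lt_or_ge F.totalDegree i with hi | hi
  · rw [homogeneousComponent_eq_zero _ _ hi, map_zero]
  · have hcoeff := congrArg (Polynomial.coeff · i) hp
    simpa only [p, Polynomial.finsetSum_coeff, Polynomial.coeff_monomial, Finset.sum_ite_eq',
      Finset.mem_range, Nat.lt_succ_iff, if_pos hi, Polynomial.coeff_zero] using hcoeff

attribute [local instance] MvPolynomial.gradedAlgebra

theorem coe_decompose_homogeneousSubmodule {σ R : Type*} [CommSemiring R] (F : MvPolynomial σ R)
    (i : ℕ) :
    (DirectSum.decompose (homogeneousSubmodule σ R) F i : MvPolynomial σ R) =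
      homogeneousComponent i F :=
  decomposition.decompose'_apply F i

theorem isHomogeneous_homogeneousIdeal [Infinite K] (X : Set (PSpace K r)) :
    (homogeneousIdeal X).IsHomogeneous (homogeneousSubmodule (Fin (r + 1)) K) := by
  intro i F hF v hv
  rw [coe_decompose_homogeneousSubmodule]
  exact eval_homogeneousComponent_eq_zero (fun t ht => hF _ (smul_mem_affineCone hv ht)) i

theorem isZariskiClosed_zeroLocus {F : MvPolynomial (Fin (r + 1)) K} {e : ℕ}
    (hF : F.IsHomogeneous e) :
    IsZariskiClosed {p : PSpace K r | ∀ v ∈ affineCone {p}, eval v F = 0} :=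
  ⟨{F}, by rintro _ rfl; exact ⟨e, hF⟩, by simp only [Set.mem_singleton_iff, forall_eq]⟩

theorem IsProjectiveVariety.mem_or_mem_homogeneousIdeal (hX : IsProjectiveVariety X) {e e' : ℕ}
    {F G : MvPolynomial (Fin (r + 1)) K} (hF : F.IsHomogeneous e) (hG : G.IsHomogeneous e')
    (hFG : F * G ∈ homogeneousIdeal X) : F ∈ homogeneousIdeal X ∨ G ∈ homogeneousIdeal X := by
  have eval_eq_zero : ∀ {e : ℕ} {F : MvPolynomial (Fin (r + 1)) K}, F.IsHomogeneous e →
      ∀ p : PSpace K r, eval p.rep F = 0 → ∀ v ∈ affineCone {p}, eval v F = 0 := by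
    rintro e F hF p hp v ⟨hv, hvp⟩
    rw [Set.mem_singleton_iff, ← p.mk_rep] at hvp
    obtain ⟨t, rfl⟩ := (Projectivization.mk_eq_mk_iff' K _ _ _ _).1 hvp
    rw [eval_smul_of_isHomogeneous hF, hp, mul_zero]
  refine (hX.irreducible _ _ (isZariskiClosed_zeroLocus hF) (isZariskiClosed_zeroLocus hG)
    fun p hp => ?_).imp (fun h v hv => h hv.2 v ⟨hv.1, rfl⟩) (fun h v hv => h hv.2 v ⟨hv.1, rfl⟩)
  have hrep := hFG p.rep ⟨p.rep_nonzero, by rwa [p.mk_rep]⟩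
  rw [map_mul, mul_eq_zero] at hrep
  exact hrep.imp (eval_eq_zero hF p) (eval_eq_zero hG p)

theorem IsProjectiveVariety.isPrime_homogeneousIdeal [Infinite K] (hX : IsProjectiveVariety X) :
    (homogeneousIdeal X).IsPrime := by
  refine (isHomogeneous_homogeneousIdeal X).isPrime_of_homogeneous_mem_or_mem ?_ ?_
  · obtain ⟨p, hp⟩ := hX.nonempty
    rw [Ideal.ne_top_iff_one]
    intro h1
    simpa only [map_one, one_ne_zero] using h1 p.rep ⟨p.rep_nonzero, by rwa [p.mk_rep]⟩
  · rintro F G ⟨e, hF⟩ ⟨e', hG⟩ hFG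
    exact hX.mem_or_mem_homogeneousIdeal hF hG hFG

theorem IdealGeneratedInDegreeLE.mono {m d : ℕ} (h : IdealGeneratedInDegreeLE X m) (hmd : m ≤ d) :
    IdealGeneratedInDegreeLE X d :=
  le_antisymm
    (h.le.trans (Ideal.span_mono fun _ hF => ⟨hF.1, hF.2.imp fun _ he => ⟨he.1.trans hmd, he.2⟩⟩))
    (Ideal.span_le.2 fun _ hF => hF.1)

end Cone

section Embedding

open MvPolynomial

variable {K : Type*} [Field K] {r N d : ℕ} {X : Set (PSpace K r)}

theorem mem_homogeneousIdeal_imageBySections [IsAlgClosed K] (hd : d ≠ 0)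
    {s : Fin (N + 1) → sections X d} (hs : ∀ v, (fun i => (s i).1 v) ≠ 0)
    {P : MvPolynomial (Fin (N + 1)) K} :
    P ∈ homogeneousIdeal (imageBySections X s) ↔ ∀ v, eval (fun i => (s i).1 v) P = 0 := by
  refine ⟨fun h v => h _ ⟨hs v, v, hs v, rfl⟩, ?_⟩
  rintro h w ⟨hw, v, hv, hwv⟩
  obtain ⟨c, rfl⟩ := (Projectivization.mk_eq_mk_iff' K _ _ hw hv).1 hwv
  obtain ⟨t, rfl⟩ := IsAlgClosed.exists_pow_nat_eq c (Nat.pos_of_ne_zero hd)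
  have ht : t ≠ 0 := by
    rintro rfl
    rw [zero_pow hd, zero_smul] at hw
    exact hw rfl
  have hscale := h ⟨t • v.1, smul_mem_affineCone v.2 ht⟩
  simp only [sections_apply_smul _ v ht] at hscale
  exact hscale

section CoordinateForm

variable (b : Module.Basis (Fin (N + 1)) K (sections X d))

/-- The linear form in the coordinates of `ℙ^N` given by a form of degree `d` on `ℙ^r`, where `ℙ^N`
is the target of the embedding of `X` by a basis `b` of `H⁰(X, O_X(d))`. For the map to be defined
on all polynomials, a polynomial is first replaced by its component of degree `d`. -/
noncomputable def coordinateForm :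
    MvPolynomial (Fin (r + 1)) K →ₗ[K] MvPolynomial (Fin (N + 1)) K :=
  linearForm K (Fin (N + 1)) ∘ₗ b.equivFun.toLinearMap ∘ₗ restrictForms X d ∘ₗ
    (homogeneousComponent d).codRestrict _ (homogeneousComponent_mem d)

theorem coordinateForm_apply (F : homogeneousSubmodule (Fin (r + 1)) K d) :
    coordinateForm b F = linearForm K _ (b.equivFun (restrictForms X d F)) := by
  have hF : (homogeneousComponent d).codRestrict _ (homogeneousComponent_mem d) F.1 = F :=
    Subtype.ext (homogeneousComponent_eq_self F.2)
  simp only [coordinateForm, LinearMap.comp_apply, LinearEquiv.coe_coe, hF]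

variable {b}

theorem eval_coordinateForm {F : MvPolynomial (Fin (r + 1)) K} (hF : F.IsHomogeneous d)
    (v : affineCone X) : eval (fun i => (b i).1 v) (coordinateForm b F) = eval v.1 F := by
  have hsum := congrFun (congrArg Subtype.val (b.sum_equivFun (restrictForms X d ⟨F, hF⟩))) v
  rw [Submodule.coe_sum, Finset.sum_apply] at hsum
  rw [coordinateForm_apply b ⟨F, hF⟩, eval_linearForm]
  exact hsum

theorem coordinateForm_eq_zero_iff {F : MvPolynomial (Fin (r + 1)) K} (hF : F.IsHomogeneous d) :
    coordinateForm b F = 0 ↔ F ∈ homogeneousIdeal X := by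
  refine ⟨fun h v hv => ?_, fun h => ?_⟩
  · rw [← eval_coordinateForm hF ⟨v, hv⟩, h, map_zero]
  · rw [coordinateForm_apply b ⟨F, hF⟩, restrictForms_eq_zero_iff.2 h, map_zero, map_zero]

theorem coordinateForm_eq_X {F : homogeneousSubmodule (Fin (r + 1)) K d} {i : Fin (N + 1)}
    (hF : restrictForms X d F = b i) : coordinateForm b F = MvPolynomial.X i := by
  classical
  have hcoords : b.equivFun (b i) = Pi.single i 1 := by
    rw [b.equivFun_apply, b.repr_self, Finsupp.single_eq_pi_single]
  rw [coordinateForm_apply, hF, hcoords, linearForm, Fintype.linearCombination_apply_single,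
    one_smul]

theorem IsNormalInDegree.exists_coordinateForm_eq (hX : IsNormalInDegree X d)
    (a : Fin (N + 1) → K) :
    ∃ F : MvPolynomial (Fin (r + 1)) K, F.IsHomogeneous d ∧
      coordinateForm b F = linearForm K _ a := by
  obtain ⟨F, hF⟩ := hX (b.equivFun.symm a)
  exact ⟨F, F.2, by rw [coordinateForm_apply, hF, LinearEquiv.apply_symm_apply]⟩

variable (b) in
theorem basis_apply_ne_zero (v : affineCone X) : (fun i => (b i).1 v) ≠ 0 := by
  obtain ⟨j, hj⟩ := Function.ne_iff.1 v.2.1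
  intro h
  have heval := eval_coordinateForm (b := b) (isHomogeneous_X_pow j d) v
  rw [h, coordinateForm_apply b ⟨_, isHomogeneous_X_pow j d⟩, eval_linearForm, map_pow, eval_X]
    at heval
  exact pow_ne_zero d hj (heval.symm.trans (dotProduct_zero _))

theorem homogeneousIdeal_imageBySections_basis [IsAlgClosed K] (hd : d ≠ 0)
    {f : Fin (N + 1) → homogeneousSubmodule (Fin (r + 1)) K d}
    (hf : ∀ i, restrictForms X d (f i) = b i) :
    homogeneousIdeal (imageBySections X b) =
      (homogeneousIdeal X).comap (aeval fun i => (f i).1) := by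
  ext P
  have heval (v : affineCone X) :
      eval v.1 (aeval (fun i => (f i).1) P) = eval (fun i => (b i).1 v) P := by
    simp only [← hf]
    exact eval₂Hom_bind₁ (RingHom.id K) v.1 (fun i => (f i).1) P
  simp only [mem_homogeneousIdeal_imageBySections hd (basis_apply_ne_zero b), Ideal.mem_comap,
    mem_homogeneousIdeal, ← heval, Subtype.forall]

theorem coordinateForm_mul_sub_sq_mem [IsAlgClosed K] (hd : 2 ≤ d)
    {s t h : MvPolynomial (Fin (r + 1)) K} (hs : s.IsHomogeneous 1) (ht : t.IsHomogeneous 1)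
    (hh : h.IsHomogeneous (d - 2)) :
    coordinateForm b (s ^ 2 * h) * coordinateForm b (t ^ 2 * h) - coordinateForm b (s * t * h) ^ 2 ∈
      homogeneousIdeal (imageBySections X b) := by
  have hdeg {q : MvPolynomial (Fin (r + 1)) K} (hq : q.IsHomogeneous 2) :
      (q * h).IsHomogeneous d := Nat.add_sub_of_le hd ▸ hq.mul hh
  rw [mem_homogeneousIdeal_imageBySections (by omega) (basis_apply_ne_zero b)]
  intro v
  rw [map_sub, map_mul, map_pow, eval_coordinateForm (hdeg (hs.pow 2)),
    eval_coordinateForm (hdeg (ht.pow 2)), eval_coordinateForm (hdeg (hs.mul ht))]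
  simp only [map_mul, map_pow]
  ring

theorem propertyQR_three_imageBySections [IsAlgClosed K] (h3 : (3 : K) = 0)
    (hI : homogeneousIdeal X ≠ ⊤) (hd : 3 ≤ d) (hnorm : IsNormalInDegree X d)
    (hgen : IdealGeneratedInDegreeLE X d) : PropertyQR (imageBySections X b) 3 := by
  have : NeZero (2 : K) := ⟨fun h2 => one_ne_zero (α := K) (by linear_combination h3 - h2)⟩
  choose f hf using fun i => hnorm (b i)
  refine le_antisymm ?_ (Ideal.span_le.2 fun q hq => hq.1)
  conv_lhs => rw [homogeneousIdeal_imageBySections_basis (by omega) hf]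
  refine comap_aeval_le h3 hd (fun i => (f i).2) (fun i => coordinateForm_eq_X (hf i))
    (fun s t h hs ht hh => ?_) hI hgen (fun F hF hFd => ?_)
  · refine Ideal.subset_span ⟨coordinateForm_mul_sub_sq_mem (by omega) hs ht hh, ?_⟩
    exact exists_isQuadricOfRank_mul_sub_sq _ _ _
  · rw [(coordinateForm_eq_zero_iff hFd).2 hF]
    exact zero_mem _

theorem exists_eq_smul_of_linearForm_mul_eq_sq {ι : Type*} [Fintype ι] {a c : ι → K}
    {P : MvPolynomial ι K} (h : linearForm K ι a * P = linearForm K ι c ^ 2) :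
    ∃ k : K, k • a = c := by
  classical
  have hker : ⨅ _ : Unit, LinearMap.ker (dotProductEquiv K ι a) ≤
      LinearMap.ker (dotProductEquiv K ι c) := by
    rw [iInf_const]
    intro y hy
    have heval := congrArg (eval y) h
    rw [map_mul, map_pow, eval_linearForm, eval_linearForm,
      show a ⬝ᵥ y = 0 from hy, zero_mul] at heval
    exact pow_eq_zero_iff two_ne_zero |>.1 heval.symm
  have hspan := mem_span_of_iInf_ker_le_ker hker
  rw [Set.range_const, Submodule.mem_span_singleton] at hspan
  obtain ⟨k, hk⟩ := hspan
  exact ⟨k, (dotProductEquiv K ι).injective (by rw [map_smul, hk])⟩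

theorem sub_smul_mem_of_coordinateForm_mul_eq_sq {F G H : MvPolynomial (Fin (r + 1)) K}
    (hF : F.IsHomogeneous d) (hH : H.IsHomogeneous d)
    (h : coordinateForm b F * coordinateForm b G = coordinateForm b H ^ 2) :
    ∃ k : K, H - k • F ∈ homogeneousIdeal X := by
  rw [coordinateForm_apply b ⟨F, hF⟩, coordinateForm_apply b ⟨H, hH⟩] at h
  obtain ⟨k, hk⟩ := exists_eq_smul_of_linearForm_mul_eq_sq h
  refine ⟨k, (coordinateForm_eq_zero_iff (b := b)
    ((homogeneousSubmodule _ K d).sub_mem hH ((homogeneousSubmodule _ K d).smul_mem k hF))).1 ?_⟩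
  rw [map_sub, map_smul, coordinateForm_apply b ⟨F, hF⟩, coordinateForm_apply b ⟨H, hH⟩, ← hk,
    map_smul, sub_self]

theorem homogeneousIdeal_imageBySections_eq_bot [IsAlgClosed K]
    (hX : (homogeneousIdeal X).IsPrime) (hd : d ≠ 0) (hnorm : IsNormalInDegree X d) {k : ℕ}
    (hk : k ≤ 2) (hQR : PropertyQR (imageBySections X b) k) :
    homogeneousIdeal (imageBySections X b) = ⊥ := by
  rw [hQR, Ideal.span_eq_bot]
  rintro q ⟨hq, ρ, hρ, hqρ⟩
  obtain ⟨a, c, rfl⟩ := hqρ.exists_eq_mul (hρ.trans hk)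
  obtain ⟨F, hF, hFa⟩ := hnorm.exists_coordinateForm_eq (b := b) a
  obtain ⟨G, hG, hGc⟩ := hnorm.exists_coordinateForm_eq (b := b) c
  rw [← hFa, ← hGc] at hq ⊢
  have hFG : F * G ∈ homogeneousIdeal X := by
    intro v hv
    rw [mem_homogeneousIdeal_imageBySections hd (basis_apply_ne_zero b)] at hq
    rw [map_mul, ← eval_coordinateForm (b := b) hF ⟨v, hv⟩,
      ← eval_coordinateForm (b := b) hG ⟨v, hv⟩, ← map_mul, hq]
  rcases hX.mem_or_mem hFG with h | h
  · rw [(coordinateForm_eq_zero_iff hF).2 h, zero_mul]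
  · rw [(coordinateForm_eq_zero_iff hG).2 h, mul_zero]

theorem eq_zero_of_linearForm_mem_homogeneousIdeal (hlin : Function.Injective (restrictForms X 1))
    {a : Fin (r + 1) → K} (ha : linearForm K _ a ∈ homogeneousIdeal X) : a = 0 := by
  have hzero : restrictForms X 1 ⟨linearForm K _ a, isHomogeneous_linearForm a⟩ = 0 :=
    restrictForms_eq_zero_iff.2 ha
  have hform := congrArg Subtype.val (hlin (hzero.trans (map_zero _).symm))
  exact linearForm_injective (hform.trans (map_zero _).symm)

theorem not_propertyQR_imageBySections_of_le_two [IsAlgClosed K]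
    (hX : (homogeneousIdeal X).IsPrime) (hlin : Function.Injective (restrictForms X 1))
    (hr : r ≠ 0) (hd : 2 ≤ d) (hnorm : IsNormalInDegree X d) {k : ℕ} (hk : k ≤ 2) :
    ¬ PropertyQR (imageBySections X b) k := by
  intro hQR
  let e₀ : Fin (r + 1) → K := Pi.single 0 1
  let e₁ : Fin (r + 1) → K := Pi.single (Fin.last r) 1
  have hindep (c : K) : e₁ - c • e₀ ≠ 0 := fun h => by
    simpa [e₀, e₁, hr] using congrFun h (Fin.last r)
  have hs := isHomogeneous_linearForm e₀
  have ht := isHomogeneous_linearForm e₁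
  set s := linearForm K _ e₀
  set t := linearForm K _ e₁
  have hh : (s ^ (d - 2)).IsHomogeneous (d - 2) := by simpa only [one_mul] using hs.pow (d - 2)
  have hdeg {q : MvPolynomial (Fin (r + 1)) K} (hq : q.IsHomogeneous 2) :
      (q * s ^ (d - 2)).IsHomogeneous d := by
    simpa only [Nat.add_sub_of_le hd] using hq.mul hh
  have hrel := coordinateForm_mul_sub_sq_mem (b := b) hd hs ht hh
  rw [homogeneousIdeal_imageBySections_eq_bot hX (by omega) hnorm hk hQR, Ideal.mem_bot,
    sub_eq_zero] at hrel
  obtain ⟨c, hc⟩ :=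
    sub_smul_mem_of_coordinateForm_mul_eq_sq (hdeg (hs.pow 2)) (hdeg (hs.mul ht)) hrel
  have hfactor : s * t * s ^ (d - 2) - c • (s ^ 2 * s ^ (d - 2)) =
      linearForm K _ (e₁ - c • e₀) * s ^ (d - 1) := by
    rw [map_sub, map_smul, show d - 1 = d - 2 + 1 by omega, smul_eq_C_mul, smul_eq_C_mul]
    ring
  rcases hX.mem_or_mem (hfactor ▸ hc) with hmem | hmem
  · exact hindep c (eq_zero_of_linearForm_mem_homogeneousIdeal hlin hmem)
  · have he₀ := eq_zero_of_linearForm_mem_homogeneousIdeal hlin (hX.mem_of_pow_mem _ hmem)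
    exact one_ne_zero (Pi.single_eq_zero_iff.1 he₀)

end CoordinateForm

theorem exists_basis_sections (hI : homogeneousIdeal X ≠ ⊤) (hnorm : IsNormalInDegree X d) :
    ∃ N : ℕ, Nonempty (Module.Basis (Fin (N + 1)) K (sections X d)) := by
  have : Module.Finite K (homogeneousSubmodule (Fin (r + 1)) K d) :=
    Module.Finite.iff_fg.2 (homogeneousSubmodule_fg _ _ _)
  have : Module.Finite K (sections X d) := Module.Finite.of_surjective _ hnorm
  have : Nontrivial (sections X d) := by
    simp only [Ne, Ideal.eq_top_iff_one, mem_homogeneousIdeal, not_forall] at hI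
    obtain ⟨v, hv, -⟩ := hI
    obtain ⟨j, hj⟩ := Function.ne_iff.1 hv.1
    refine ⟨restrictForms X d ⟨MvPolynomial.X j ^ d, isHomogeneous_X_pow j d⟩, 0, fun h => hj ?_⟩
    have heval := restrictForms_eq_zero_iff.1 h v hv
    rw [map_pow, eval_X] at heval
    exact eq_zero_of_pow_eq_zero heval
  exact ⟨Module.finrank K (sections X d) - 1, ⟨Module.finBasisOfFinrankEq K _
    (Nat.sub_add_cancel Module.finrank_pos).symm⟩⟩

end Embedding

theorem theorem1p2_general {K : Type*} [Field K] [IsAlgClosed K] [CharP K 3] {r : ℕ} (hr : r ≠ 0)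
    {X : Set (PSpace K r)} (hX : (homogeneousIdeal X).IsPrime)
    (hlin : Function.Injective (restrictForms X 1)) {d : ℕ} (hd : 3 ≤ d)
    (hnorm : IsNormalInDegree X d) (hgen : IdealGeneratedInDegreeLE X d) : HasRankIndex X d 3 := by
  have h3 : (3 : K) = 0 := CharP.ofNat_eq_zero K 3
  refine ⟨exists_basis_sections hX.ne_top hnorm, fun N b =>
    ⟨propertyQR_three_imageBySections h3 hX.ne_top hd hnorm hgen, fun k hk => ?_⟩⟩
  by_contra! hk3
  exact not_propertyQR_imageBySections_of_le_two hX hlin hr (by omega) hnorm (by omega) hk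

section ProjectiveSpace

open MvPolynomial

variable {K : Type*} [Field K] {r : ℕ}

attribute [local instance] MvPolynomial.gradedAlgebra in
theorem isHomogeneous_of_mul_left {σ R : Type*} [CommRing R] [IsDomain R]
    {F G : MvPolynomial σ R} {e d : ℕ} (hF : F.IsHomogeneous e) (hF0 : F ≠ 0)
    (hFG : (F * G).IsHomogeneous (e + d)) : G.IsHomogeneous d := by
  have hcomp : F * homogeneousComponent d G = F * G := by
    rw [← coe_decompose_homogeneousSubmodule, ← DirectSum.coe_decompose_mul_add_of_left_mem _ hF,
      coe_decompose_homogeneousSubmodule, homogeneousComponent_eq_self hFG]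
  rw [← mul_left_cancel₀ hF0 hcomp]
  exact homogeneousComponent_isHomogeneous d G

theorem isUnit_of_eval_ne_zero [IsAlgClosed K] {σ : Type*} [Finite σ] [Nontrivial σ]
    {G : MvPolynomial σ K} (hG : ∀ v : σ → K, v ≠ 0 → eval v G ≠ 0) : IsUnit G := by
  have hX (i : σ) : ∃ a, G ∣ X i ^ a := by
    have hi : X i ∈ (Ideal.span {G}).radical := by
      rw [← vanishingIdeal_zeroLocus_eq_radical (K := K)]
      intro v hv
      have hv0 : v = 0 := by_contra fun hv0 => hG v hv0 (hv G (Ideal.mem_span_singleton_self G))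
      rw [hv0, aeval_X, Pi.zero_apply]
    exact hi.imp fun _ => Ideal.mem_span_singleton.1
  obtain ⟨i, j, hij⟩ := exists_pair_ne σ
  obtain ⟨a, ha⟩ := hX i
  obtain ⟨b, hb⟩ := hX j
  have hrel : IsRelPrime (X i : MvPolynomial σ K) (X j) :=
    X_prime.irreducible.isRelPrime_iff_not_dvd.2 fun h => hij (X_dvd_X.1 h)
  exact hrel.pow ha hb

theorem mul_sub_mul_mem_homogeneousIdeal {X : Set (PSpace K r)} (hX : (homogeneousIdeal X).IsPrime)
    {s : affineCone X → K} {F G F' G' : MvPolynomial (Fin (r + 1)) K}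
    (hG : G ∉ homogeneousIdeal X) (hG' : G' ∉ homogeneousIdeal X)
    (hs : ∀ w : affineCone X, eval w.1 G ≠ 0 → s w = eval w.1 F / eval w.1 G)
    (hs' : ∀ w : affineCone X, eval w.1 G' ≠ 0 → s w = eval w.1 F' / eval w.1 G') :
    F * G' - F' * G ∈ homogeneousIdeal X := by
  have hmem : (F * G' - F' * G) * (G * G') ∈ homogeneousIdeal X := by
    intro w hw
    simp only [map_mul, map_sub]
    by_cases hGw : eval w G = 0
    · simp only [hGw, zero_mul, mul_zero]
    by_cases hGw' : eval w G' = 0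
    · simp only [hGw', mul_zero]
    have hcross := (hs ⟨w, hw⟩ hGw).symm.trans (hs' ⟨w, hw⟩ hGw')
    rw [div_eq_div_iff hGw hGw'] at hcross
    rw [hcross, sub_self, zero_mul]
  exact (hX.mem_or_mem hmem).resolve_right fun h => (hX.mem_or_mem h).elim hG hG'

theorem mem_affineCone_univ {v : Fin (r + 1) → K} :
    v ∈ affineCone (Set.univ : Set (PSpace K r)) ↔ v ≠ 0 :=
  ⟨fun h => h.1, fun h => ⟨h, Set.mem_univ _⟩⟩

theorem homogeneousIdeal_univ [Infinite K] :
    homogeneousIdeal (Set.univ : Set (PSpace K r)) = ⊥ := by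
  rw [eq_bot_iff]
  intro F hF
  have hmul : F * X 0 = 0 := by
    refine MvPolynomial.funext fun v => ?_
    rw [map_mul, map_zero, eval_X]
    by_cases hv : v = 0
    · rw [hv, Pi.zero_apply, mul_zero]
    · rw [hF v (mem_affineCone_univ.2 hv), zero_mul]
  exact (mul_eq_zero.1 hmul).resolve_right (X_ne_zero 0)

theorem isPrime_homogeneousIdeal_univ [Infinite K] :
    (homogeneousIdeal (Set.univ : Set (PSpace K r))).IsPrime := by
  rw [homogeneousIdeal_univ]
  exact Ideal.isPrime_bot

theorem injective_restrictForms_univ [Infinite K] (d : ℕ) :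
    Function.Injective (restrictForms (Set.univ : Set (PSpace K r)) d) := by
  rw [injective_iff_map_eq_zero]
  intro F hF
  rw [restrictForms_eq_zero_iff, homogeneousIdeal_univ, Ideal.mem_bot] at hF
  exact Subtype.ext hF

theorem idealGeneratedInDegreeLE_univ [Infinite K] (d : ℕ) :
    IdealGeneratedInDegreeLE (Set.univ : Set (PSpace K r)) d := by
  rw [IdealGeneratedInDegreeLE, homogeneousIdeal_univ]
  exact (Ideal.span_eq_bot.2 fun F hF => hF.1).symm

theorem mul_eq_mul_of_sections_univ [Infinite K] {s : affineCone (Set.univ : Set (PSpace K r)) → K}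
    {F G F' G' : MvPolynomial (Fin (r + 1)) K} (hG : G ≠ 0) (hG' : G' ≠ 0)
    (hs : ∀ w, eval w.1 G ≠ 0 → s w = eval w.1 F / eval w.1 G)
    (hs' : ∀ w, eval w.1 G' ≠ 0 → s w = eval w.1 F' / eval w.1 G') : F * G' = F' * G := by
  have hmem := mul_sub_mul_mem_homogeneousIdeal isPrime_homogeneousIdeal_univ
    (by rwa [homogeneousIdeal_univ]) (by rwa [homogeneousIdeal_univ]) hs hs'
  rwa [homogeneousIdeal_univ, Ideal.mem_bot, sub_eq_zero] at hmem

theorem ne_zero_of_eval_ne_zero {σ R : Type*} [CommSemiring R] {v : σ → R} {F : MvPolynomial σ R}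
    (h : eval v F ≠ 0) : F ≠ 0 := by
  rintro rfl
  exact h (map_zero _)

theorem dvd_of_sections_univ [IsAlgClosed K] (hr : r ≠ 0) {d : ℕ}
    (s : sections (Set.univ : Set (PSpace K r)) d) {F G : MvPolynomial (Fin (r + 1)) K}
    (hG : G ≠ 0) (hs : ∀ w, eval w.1 G ≠ 0 → s.1 w = eval w.1 F / eval w.1 G) : G ∣ F := by
  have : Nontrivial (Fin (r + 1)) := Fin.nontrivial_iff_two_le.2 (by omega)
  obtain ⟨G₁, F₁, H, hrel, rfl, rfl⟩ := UniqueFactorizationMonoid.exists_reduced_factors G hG F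
  have hunit : IsUnit G₁ := isUnit_of_eval_ne_zero fun v hv hG₁v => by
    obtain ⟨e, F', G', -, -, hG'v, hs'⟩ := s.2 ⟨v, mem_affineCone_univ.2 hv⟩
    have hcross := mul_eq_mul_of_sections_univ hG (ne_zero_of_eval_ne_zero hG'v) hs hs'
    have hcancel : F₁ * G' = F' * G₁ :=
      mul_left_cancel₀ (left_ne_zero_of_mul hG) (by linear_combination hcross)
    obtain ⟨D, rfl⟩ := hrel.dvd_of_dvd_mul_left ⟨F', hcancel.trans (mul_comm _ _)⟩
    exact hG'v (by rw [map_mul, hG₁v, zero_mul])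
  exact mul_dvd_mul_left H hunit.dvd

theorem isNormalInDegree_univ [IsAlgClosed K] (hr : r ≠ 0) (d : ℕ) :
    IsNormalInDegree (Set.univ : Set (PSpace K r)) d := by
  intro s
  obtain ⟨e, _, G, hFG, hG, hGv, hs⟩ :=
    s.2 ⟨Pi.single 0 1, mem_affineCone_univ.2 (Pi.single_ne_zero_iff.2 one_ne_zero)⟩
  have hG0 := ne_zero_of_eval_ne_zero hGv
  obtain ⟨F, rfl⟩ := dvd_of_sections_univ hr s hG0 hs
  refine ⟨⟨F, isHomogeneous_of_mul_left hG hG0 hFG⟩, Subtype.ext (funext fun v => ?_)⟩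
  obtain ⟨e', F', G', -, -, hG'v, hs'⟩ := s.2 v
  have hcross := mul_eq_mul_of_sections_univ hG0 (ne_zero_of_eval_ne_zero hG'v) hs hs'
  have hF' : F * G' = F' := mul_right_cancel₀ hG0 (by linear_combination hcross)
  rw [hs' v hG'v, ← hF', map_mul, mul_div_cancel_right₀ _ hG'v]
  rfl

variable (K) in
theorem subsingleton_pSpace_zero : Subsingleton (PSpace K 0) := by
  refine ⟨fun p q => ?_⟩
  have hq : q.rep 0 ≠ 0 := fun h => q.rep_nonzero (funext fun i => by rwa [Fin.fin_one_eq_zero i])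
  rw [← p.mk_rep, ← q.mk_rep]
  refine (Projectivization.mk_eq_mk_iff' K _ _ _ _).2 ⟨p.rep 0 / q.rep 0, funext fun i => ?_⟩
  rw [Fin.fin_one_eq_zero i, Pi.smul_apply, smul_eq_mul, div_mul_cancel₀ _ hq]

theorem ne_zero_of_nontrivial {X : Set (PSpace K r)} (hX : X.Nontrivial) : r ≠ 0 := by
  rintro rfl
  have := subsingleton_pSpace_zero K
  exact Set.not_subsingleton_iff.2 hX Set.subsingleton_of_subsingleton

end ProjectiveSpace

theorem theorem1p2 (K : Type*) [Field K] [IsAlgClosed K] [CharP K 3] :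
    (∀ n d : ℕ, 2 ≤ n → 3 ≤ d → HasRankIndex (Set.univ : Set (PSpace K n)) d 3) ∧
      (∀ (r : ℕ) (X : Set (PSpace K r)), IsProjectiveVariety X → X.Nontrivial →
        IsLinearlyNormallyEmbedded X →
        ∀ m : ℕ, 3 ≤ m → (∀ j : ℕ, m ≤ j → IsNormalInDegree X j) →
          IdealGeneratedInDegreeLE X m →
          ∀ d : ℕ, m ≤ d → HasRankIndex X d 3) :=
  ⟨fun _ d hn hd => theorem1p2_general (by omega) isPrime_homogeneousIdeal_univ
      (injective_restrictForms_univ 1) hd (isNormalInDegree_univ (by omega) d)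
      (idealGeneratedInDegreeLE_univ d),
    fun _ _ hX hnt hL _ hm hnorm hgen d hd => theorem1p2_general (ne_zero_of_nontrivial hnt)
      hX.isPrime_homogeneousIdeal hL.1 (hm.trans hd) (hnorm d hd) (hgen.mono hd)⟩
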